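/- Let $S^1$ be the unit circle in $\mathbb C$ with base point $1$, and let $m, r \ge 0$ be integers. Let $(S^1)^{\vee m}$ be the wedge of $m$ copies of $S^1$ (a point if $m = 0$), and for a space $X$ let $\mathrm{Sym}^r(X)$ be the quotient of $X^r$ by the symmetric group permuting the factors. For $I \subseteq \{1, \dots, m\}$ put $$(S^1)^I = \{(x_1, \dots, x_m) \in (S^1)^m : x_i = 1 \text{ if } i \notin I\}.$$ 1. If $r \ge m$, then $\mathrm{Sym}^r((S^1)^{\vee m})$ is homotopy equivalent to the $m$-torus $(S^1)^m$. 2. If $r < m$, then $\mathrm{Sym}^r((S^1)^{\vee m})$ is homotopy equivalent to the union of the $\binom{m}{r}$ coordinate subtori $(S^1)^I$ with $|I| = r$, $$\bigcup_{|I| = r} (S^1)^I \subset (S^1)^m .$$ Moreover, this union is the $r$-skeleton of $(S^1)^m$ with its product CW structure, where $S^1$ has the single $0$-cell $1$ and a single $1$-cell. -/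

import Mathlib

open Set Topology
open scoped ContinuousMap

noncomputable section

/-- The relation on `r`-tuples of being equal up to a permutation of the entries. -/
def symmetricProductSetoid (r : ℕ) (X : Type*) : Setoid (Fin r → X) where
  r f g := ∃ σ : Equiv.Perm (Fin r), f ∘ σ = g
  iseqv :=
    { refl := fun f => ⟨1, rfl⟩
      symm := by
        rintro f g ⟨σ, rfl⟩
        exact ⟨σ⁻¹, by funext i; simp⟩
      trans := by
        rintro f g h ⟨σ, rfl⟩ ⟨τ, rfl⟩
        exact ⟨σ * τ, rfl⟩ }

/-- The `r`-fold symmetric product `Sym^r X`: the space of unordered `r`-tuples of points of `X`,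
i.e. the quotient of `X^r` by the action of the symmetric group permuting the factors. -/
def SymmetricProduct (r : ℕ) (X : Type*) : Type _ := Quotient (symmetricProductSetoid r X)

/-- The symmetric product carries the quotient topology of the product topology. -/
instance symmetricProductTopology (r : ℕ) (X : Type*) [TopologicalSpace X] : TopologicalSpace (SymmetricProduct r X) :=
  inferInstanceAs (TopologicalSpace (Quotient (symmetricProductSetoid r X)))

/-- The points that are identified in a wedge of pointed spaces: an extra point (which makes the
empty wedge a one-point space) and the base points of all the spaces. -/
def IsWedgePoint {ι : Type*} {X : ι → Type*} (x₀ : ∀ i, X i) : Unit ⊕ (Σ i, X i) → Prop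
  | Sum.inl _ => True
  | Sum.inr p => p.2 = x₀ p.1

/-- The relation that identifies all base points with each other, and nothing else. -/
def wedgeSetoid {ι : Type*} {X : ι → Type*} (x₀ : ∀ i, X i) : Setoid (Unit ⊕ (Σ i, X i)) where
  r a b := a = b ∨ (IsWedgePoint x₀ a ∧ IsWedgePoint x₀ b)
  iseqv :=
    { refl := fun _ => Or.inl rfl
      symm := by
        rintro a b (rfl | ⟨h, h'⟩)
        · exact Or.inl rfl
        · exact Or.inr ⟨h', h⟩
      trans := by
        rintro a b c (rfl | ⟨h, h'⟩) (rfl | ⟨k, k'⟩)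
        · exact Or.inl rfl
        · exact Or.inr ⟨k, k'⟩
        · exact Or.inr ⟨h, h'⟩
        · exact Or.inr ⟨h, k'⟩ }

/-- The wedge of a family of pointed spaces `(X i, x₀ i)`: the disjoint union of the `X i`
with all the base points identified to one point. -/
def Wedge {ι : Type*} {X : ι → Type*} (x₀ : ∀ i, X i) : Type _ := Quotient (wedgeSetoid x₀)

/-- The wedge carries the quotient topology of the disjoint union topology. -/
instance wedgeTopology {ι : Type*} {X : ι → Type*} [∀ i, TopologicalSpace (X i)] (x₀ : ∀ i, X i) :
    TopologicalSpace (Wedge x₀) :=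
  inferInstanceAs (TopologicalSpace (Quotient (wedgeSetoid x₀)))

/-- The wedge of `m` copies of the unit circle, based at `1`. -/
abbrev WedgeOfCircles (m : ℕ) : Type := Wedge (fun _ : Fin m => (1 : Circle))

/-- The coordinate subtorus `(S¹)^I` of the `m`-torus `(S¹)^m`: the points all of whose
coordinates outside `I` are `1`. -/
def coordSubtorus {m : ℕ} (I : Finset (Fin m)) : Set (Fin m → Circle) :=
  {x | ∀ i, i ∉ I → x i = 1}

/-! ### The product CW structure on the torus

The circle has one `0`-cell, the point `1`, and one `1`-cell, with characteristic map
`[-1, 1] → S¹`, `t ↦ -exp (π i t) = exp (π i (t + 1))`. A cell of the product `(S¹)^m` is a product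
of these cells, so it is given by the set `I` of those factors in which the `1`-cell is chosen;
its dimension is the number of elements of `I`. -/

/-- The characteristic map of the `1`-cell of the circle. -/
def circleCell (t : ℝ) : Circle := -Circle.exp (Real.pi * t)

/-- The inverse on the open `1`-cell of `circleCell`. -/
def circleCellInv (z : Circle) : ℝ := Complex.arg (-z : Circle) / Real.pi

lemma continuous_circleCell : Continuous circleCell := by
  unfold circleCell
  fun_prop

lemma circleCellInv_circleCell {t : ℝ} (h₁ : -1 < t) (h₂ : t ≤ 1) :
    circleCellInv (circleCell t) = t := by
  have hp := Real.pi_pos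
  unfold circleCellInv circleCell
  rw [neg_neg, Circle.arg_exp (by nlinarith) (by nlinarith)]
  field_simp

lemma circleCell_circleCellInv (z : Circle) : circleCell (circleCellInv z) = z := by
  unfold circleCellInv circleCell
  rw [mul_div_cancel₀ _ Real.pi_ne_zero, Circle.exp_arg, neg_neg]

lemma circleCell_one : circleCell 1 = 1 := by
  apply Circle.ext
  simp [circleCell]

lemma circleCell_neg_one : circleCell (-1) = 1 := by
  apply Circle.ext
  simp [circleCell]

lemma circleCellInv_one : circleCellInv 1 = 1 := by
  simpa [circleCell_one] using circleCellInv_circleCell (t := 1) (by norm_num) le_rfl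

lemma circleCellInv_mem (z : Circle) : -1 < circleCellInv z ∧ circleCellInv z ≤ 1 := by
  have hp := Real.pi_pos
  unfold circleCellInv
  rw [lt_div_iff₀ hp, div_le_iff₀ hp]
  constructor
  · simpa using Complex.neg_pi_lt_arg _
  · simpa using Complex.arg_le_pi _

lemma circleCellInv_lt_one {z : Circle} (hz : z ≠ 1) : circleCellInv z < 1 := by
  refine lt_of_le_of_ne (circleCellInv_mem z).2 fun h => hz ?_
  rw [← circleCell_circleCellInv z, h, circleCell_one]

lemma circleCell_ne_one {t : ℝ} (h₁ : -1 < t) (h₂ : t < 1) : circleCell t ≠ 1 := by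
  intro h
  have := circleCellInv_circleCell h₁ h₂.le
  rw [h, circleCellInv_one] at this
  linarith

lemma continuousAt_circleCellInv {z : Circle} (hz : z ≠ 1) : ContinuousAt circleCellInv z := by
  unfold circleCellInv
  refine ContinuousAt.div_const ?_ _
  have h : ((-z : Circle) : ℂ) ∈ Complex.slitPlane := by
    rw [Complex.mem_slitPlane_iff_arg]
    refine ⟨fun h => ?_, Circle.coe_ne_zero _⟩
    have h' := circleCellInv_lt_one hz
    unfold circleCellInv at h'
    rw [h, div_self Real.pi_ne_zero] at h'
    exact lt_irrefl _ h'
  exact ContinuousAt.comp (f := fun w : Circle => ((-w : Circle) : ℂ))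
    (Complex.continuousAt_arg h) (by fun_prop)

/-- The characteristic map of the cell of the torus given by the set `I`: a point of the cube
`[-1, 1]^n`, whose coordinates are matched with the elements of `I` in increasing order, is sent
by `circleCell` in each of these coordinates; the other coordinates are `1`. -/
def torusCell {m n : ℕ} (I : Finset (Fin m)) (hI : I.card = n) (y : Fin n → ℝ) : Fin m → Circle :=
  fun i => if h : i ∈ I then circleCell (y ((I.orderIsoOfFin hI).symm ⟨i, h⟩)) else 1

/-- The inverse on the open cell of `torusCell`. -/
def torusCellInv {m n : ℕ} (I : Finset (Fin m)) (hI : I.card = n) (x : Fin m → Circle) :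
    Fin n → ℝ :=
  fun k => circleCellInv (x (I.orderIsoOfFin hI k))

/-- The open cell of the torus given by `I`. -/
def torusOpenCell {m : ℕ} (I : Finset (Fin m)) : Set (Fin m → Circle) :=
  {x | ∀ i, x i ≠ 1 ↔ i ∈ I}

lemma torusCell_mem {m n : ℕ} (I : Finset (Fin m)) (hI : I.card = n) {y : Fin n → ℝ}
    (hy : y ∈ Metric.ball (0 : Fin n → ℝ) 1) : torusCell I hI y ∈ torusOpenCell I := by
  intro i
  by_cases h : i ∈ I
  · simp only [torusCell, h, dif_pos, iff_true]
    have := (pi_norm_lt_iff one_pos).1 (mem_ball_zero_iff.1 hy)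
      ((I.orderIsoOfFin hI).symm ⟨i, h⟩)
    rw [Real.norm_eq_abs, abs_lt] at this
    exact circleCell_ne_one this.1 this.2
  · simp [torusCell, h]

lemma torusCellInv_mem {m n : ℕ} (I : Finset (Fin m)) (hI : I.card = n) {x : Fin m → Circle}
    (hx : x ∈ torusOpenCell I) : torusCellInv I hI x ∈ Metric.ball (0 : Fin n → ℝ) 1 := by
  rw [mem_ball_zero_iff, pi_norm_lt_iff one_pos]
  intro k
  rw [Real.norm_eq_abs, abs_lt]
  exact ⟨(circleCellInv_mem _).1, circleCellInv_lt_one ((hx _).2 (I.orderIsoOfFin hI k).2)⟩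

lemma torusCellInv_torusCell {m n : ℕ} (I : Finset (Fin m)) (hI : I.card = n) {y : Fin n → ℝ}
    (hy : y ∈ Metric.ball (0 : Fin n → ℝ) 1) : torusCellInv I hI (torusCell I hI y) = y := by
  funext k
  have := (pi_norm_lt_iff one_pos).1 (mem_ball_zero_iff.1 hy) k
  rw [Real.norm_eq_abs, abs_lt] at this
  have h : ((I.orderIsoOfFin hI k : I) : Fin m) ∈ I := (I.orderIsoOfFin hI k).2
  simp only [torusCellInv, torusCell, h, dif_pos, Subtype.coe_eta, OrderIso.symm_apply_apply]
  exact circleCellInv_circleCell this.1 this.2.le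

lemma torusCell_torusCellInv {m n : ℕ} (I : Finset (Fin m)) (hI : I.card = n)
    {x : Fin m → Circle} (hx : x ∈ torusOpenCell I) :
    torusCell I hI (torusCellInv I hI x) = x := by
  funext i
  by_cases h : i ∈ I
  · simp [torusCell, torusCellInv, h, circleCell_circleCellInv]
  · have : x i = 1 := by
      by_contra h'
      exact h ((hx i).1 h')
    simp [torusCell, h, this]

lemma continuous_torusCell {m n : ℕ} (I : Finset (Fin m)) (hI : I.card = n) :
    Continuous (torusCell I hI) := by
  refine continuous_pi fun i => ?_
  by_cases h : i ∈ I
  · simp only [torusCell, h, dif_pos]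
    exact continuous_circleCell.comp (continuous_apply _)
  · simp only [torusCell, h, dif_neg, not_false_iff]
    exact continuous_const

lemma continuousOn_torusCellInv {m n : ℕ} (I : Finset (Fin m)) (hI : I.card = n) :
    ContinuousOn (torusCellInv I hI) (torusOpenCell I) := by
  refine continuousOn_pi.2 fun k x hx => ContinuousAt.continuousWithinAt ?_
  exact ContinuousAt.comp (f := fun x : Fin m → Circle => x (I.orderIsoOfFin hI k))
    (continuousAt_circleCellInv ((hx _).2 (I.orderIsoOfFin hI k).2))
    (continuous_apply _).continuousAt

lemma image_ball_torusCell {m n : ℕ} (I : Finset (Fin m)) (hI : I.card = n) :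
    torusCell I hI '' Metric.ball 0 1 = torusOpenCell I := by
  refine Subset.antisymm ?_ fun x hx => ?_
  · rintro _ ⟨y, hy, rfl⟩
    exact torusCell_mem I hI hy
  · exact ⟨_, torusCellInv_mem I hI hx, torusCell_torusCellInv I hI hx⟩

open Classical in
/-- The set of coordinates of a point of the torus that differ from the base point. -/
def torusSupport {m : ℕ} (x : Fin m → Circle) : Finset (Fin m) :=
  Finset.univ.filter fun i => x i ≠ 1

lemma mem_torusSupport {m : ℕ} {x : Fin m → Circle} {i : Fin m} :
    i ∈ torusSupport x ↔ x i ≠ 1 := by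
  simp [torusSupport]

lemma mem_torusOpenCell_support {m : ℕ} (x : Fin m → Circle) :
    x ∈ torusOpenCell (torusSupport x) := by
  exact fun i => mem_torusSupport.symm

lemma torusSupport_subset {m n : ℕ} (I : Finset (Fin m)) (hI : I.card = n) (y : Fin n → ℝ) :
    torusSupport (torusCell I hI y) ⊆ I := by
  intro i hi
  by_contra h
  exact mem_torusSupport.1 hi (by simp [torusCell, h])

lemma card_torusSupport_lt {m n : ℕ} (I : Finset (Fin m)) (hI : I.card = n) {y : Fin n → ℝ}
    (hy : y ∈ Metric.sphere (0 : Fin n → ℝ) 1) : (torusSupport (torusCell I hI y)).card < n := by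
  refine lt_of_lt_of_eq (Finset.card_lt_card ?_) hI
  refine (torusSupport_subset I hI y).ssubset_of_ne fun h => ?_
  have hb : y ∈ Metric.ball (0 : Fin n → ℝ) 1 := by
    rw [mem_ball_zero_iff, pi_norm_lt_iff one_pos]
    intro k
    have hle : ‖y k‖ ≤ 1 := (norm_le_pi_norm y k).trans (mem_sphere_zero_iff_norm.1 hy).le
    refine lt_of_le_of_ne hle fun h1 => ?_
    have hk : ((I.orderIsoOfFin hI k : I) : Fin m) ∈ torusSupport (torusCell I hI y) := by
      rw [h]
      exact (I.orderIsoOfFin hI k).2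
    have hk' : ((I.orderIsoOfFin hI k : I) : Fin m) ∈ I := (I.orderIsoOfFin hI k).2
    simp only [mem_torusSupport, torusCell, hk', dif_pos, Subtype.coe_eta,
      OrderIso.symm_apply_apply] at hk
    rw [Real.norm_eq_abs] at h1
    rcases eq_or_eq_neg_of_abs_eq h1 with h2 | h2
    · exact hk (by rw [h2, circleCell_one])
    · exact hk (by rw [h2, circleCell_neg_one])
  rw [mem_ball_zero_iff, mem_sphere_zero_iff_norm.1 hy] at hb
  exact lt_irrefl _ hb

/-- The characteristic maps as partial equivalences, from the open cube onto the open cell. -/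
def torusCellEquiv {m n : ℕ} (I : Finset (Fin m)) (hI : I.card = n) :
    PartialEquiv (Fin n → ℝ) (Fin m → Circle) where
  toFun := torusCell I hI
  invFun := torusCellInv I hI
  source := Metric.ball 0 1
  target := torusOpenCell I
  map_source' _ hy := torusCell_mem I hI hy
  map_target' _ hx := torusCellInv_mem I hI hx
  left_inv' _ hy := torusCellInv_torusCell I hI hy
  right_inv' _ hx := torusCell_torusCellInv I hI hx

lemma iUnion_torusCell {m : ℕ} :
    ⋃ (n : ℕ) (I : {I : Finset (Fin m) // I.card = n}),
      torusCell I.1 I.2 '' Metric.closedBall 0 1 = univ := by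
  refine eq_univ_of_forall fun x => mem_iUnion₂.2 ⟨_, ⟨torusSupport x, rfl⟩, ?_⟩
  refine image_mono Metric.ball_subset_closedBall ?_
  rw [image_ball_torusCell]
  exact mem_torusOpenCell_support x

/-- The product CW structure on the torus `(S¹)^m`, where the circle has a single `0`-cell `1`
and a single `1`-cell. -/
instance torusCWComplex (m : ℕ) : CWComplex (univ : Set (Fin m → Circle)) where
  cell n := {I : Finset (Fin m) // I.card = n}
  map _ I := torusCellEquiv I.1 I.2
  source_eq _ _ := rfl
  continuousOn _ I := (continuous_torusCell I.1 I.2).continuousOn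
  continuousOn_symm _ I := continuousOn_torusCellInv I.1 I.2
  pairwiseDisjoint' := by
    rintro ⟨n, I, hI⟩ - ⟨k, J, hJ⟩ - hne
    change Disjoint (torusCell I hI '' _) (torusCell J hJ '' _)
    rw [image_ball_torusCell, image_ball_torusCell, Set.disjoint_left]
    intro x hx hx'
    have h : I = J := Finset.ext fun i => (hx i).symm.trans (hx' i)
    subst h
    subst hI
    subst hJ
    exact hne rfl
  mapsTo' n I := by
    refine ⟨fun _ => Finset.univ, fun y hy => ?_⟩
    simp only [mem_iUnion]
    refine ⟨_, card_torusSupport_lt I.1 I.2 hy, ⟨_, rfl⟩, Finset.mem_univ _, ?_⟩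
    refine image_mono Metric.ball_subset_closedBall ?_
    change _ ∈ torusCell _ _ '' _
    rw [image_ball_torusCell]
    exact mem_torusOpenCell_support _
  closed' A _ hA := by
    have h : A = ⋃ I : Finset (Fin m), A ∩ torusCell I rfl '' Metric.closedBall 0 1 := by
      rw [← inter_iUnion]
      refine (inter_eq_left.2 fun x _ => ?_).symm
      refine mem_iUnion.2 ⟨torusSupport x, image_mono Metric.ball_subset_closedBall ?_⟩
      rw [image_ball_torusCell]
      exact mem_torusOpenCell_support x
    rw [h]
    exact isClosed_iUnion_of_finite fun I => hA I.card ⟨I, rfl⟩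
  union' := iUnion_torusCell

end

/-! An unordered `r`-tuple in the wedge amounts to a finite multiset of points other than `1` on
each circle, with at most `r` points altogether; the base point fills the remaining places.
Multiplying the points on each circle gives `coordProd`, a map to the torus whose values have at
most `r` coordinates different from `1`. Conversely `ofTorus` places each coordinate on its own
circle. `coordProd` after `ofTorus` is the identity on the nose.

For the other composite, write the points on each circle as `exp (2πi t)` with decreasing parameters
`t` in `[0, 1]`, and slide these linearly to the sequence `(1, …, 1, s - k, 0, …, 0)` of the same
sum (`fill`). At the end at most one point per circle differs from `1`, and it is the product of the
original points (`sameSums_fill_one`). Zero parameters stay zero (`fill_eq_zero`), so the bound `r`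
on the total number of points survives. Both `0` and `1` represent the base point, so the parameters
are not unique; the motion is well defined because trading a leading `1` for a trailing `0` does not
affect it (`fillSum_shift_one`, `sameSums_fill`).

The topology is handled by compactness. Sums of test functions vanishing at `1` embed the symmetric
product in a product of lines (`isEmbedding_testSums`), and the compact space of sorted parameters
maps onto it by a quotient map, also after multiplication with the unit interval
(`continuous_fillSymm`). -/

noncomputable section

/-! ### Coordinates on a wedge of circles -/

/-- The base point of a wedge of circles. -/
def wedgeBase (m : ℕ) : WedgeOfCircles m :=
  Quotient.mk (wedgeSetoid fun _ : Fin m => (1 : Circle)) (Sum.inl ())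

/-- The inclusion of the `i`-th circle into the wedge. -/
def wedgeIncl {m : ℕ} (i : Fin m) (z : Circle) : WedgeOfCircles m :=
  Quotient.mk (wedgeSetoid fun _ : Fin m => (1 : Circle)) (Sum.inr ⟨i, z⟩)

/-- The map of the wedge to the `i`-th circle that collapses all the other circles. -/
def wedgeCoord {m : ℕ} (i : Fin m) : WedgeOfCircles m → Circle :=
  Quotient.lift (s := wedgeSetoid fun _ : Fin m => (1 : Circle))
    (Sum.elim (fun _ => 1) fun p => if p.1 = i then p.2 else 1) (by
      have key : ∀ a : Unit ⊕ (Σ _ : Fin m, Circle), IsWedgePoint (fun _ => (1 : Circle)) a →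
          Sum.elim (fun _ => (1 : Circle)) (fun p => if p.1 = i then p.2 else 1) a = 1 := by
        rintro (_ | ⟨k, z⟩) h
        · rfl
        · have h' : z = 1 := h
          simp [h']
      rintro a b (rfl | ⟨h, h'⟩)
      · rfl
      · rw [key a h, key b h'])

@[simp] lemma wedgeCoord_base {m : ℕ} (i : Fin m) : wedgeCoord i (wedgeBase m) = 1 := rfl

lemma wedgeCoord_incl {m : ℕ} (i k : Fin m) (z : Circle) :
    wedgeCoord i (wedgeIncl k z) = if k = i then z else 1 := rfl

lemma wedge_cases {m : ℕ} (w : WedgeOfCircles m) :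
    w = wedgeBase m ∨ ∃ i z, z ≠ 1 ∧ w = wedgeIncl i z := by
  induction w using Quotient.inductionOn with
  | h a =>
    rcases a with _ | ⟨i, z⟩
    · exact Or.inl rfl
    · by_cases hz : z = 1
      · exact Or.inl (Quotient.sound (Or.inr ⟨hz, trivial⟩))
      · exact Or.inr ⟨i, z, hz, rfl⟩

/-- Away from the base point, this lets multiplicities in the wedge be counted in a single
coordinate. -/
lemma eq_wedgeIncl_iff {m : ℕ} {i : Fin m} {z : Circle} (hz : z ≠ 1) (w : WedgeOfCircles m) :
    w = wedgeIncl i z ↔ wedgeCoord i w = z := by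
  constructor
  · rintro rfl
    simp [wedgeCoord_incl]
  · rintro rfl
    rcases wedge_cases w with rfl | ⟨k, z, -, rfl⟩
    · exact absurd rfl hz
    · rw [wedgeCoord_incl] at hz ⊢
      split_ifs at hz ⊢ with h
      · rw [h]
      · exact absurd rfl hz

lemma wedgeCoord_eq_one_of_ne {m : ℕ} {i k : Fin m} {w : WedgeOfCircles m}
    (hi : wedgeCoord i w ≠ 1) (hk : k ≠ i) : wedgeCoord k w = 1 := by
  rw [(eq_wedgeIncl_iff hi w).2 rfl, wedgeCoord_incl, if_neg hk.symm]

lemma continuous_wedgeCoord {m : ℕ} (i : Fin m) : Continuous (wedgeCoord i) := by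
  refine Continuous.quotient_lift ?_ _
  refine continuous_sumElim.2 ⟨continuous_const, continuous_sigma fun k => ?_⟩
  by_cases h : k = i
  · simpa [h] using continuous_id'
  · simpa [h] using continuous_const

instance (m : ℕ) : CompactSpace (WedgeOfCircles m) :=
  inferInstanceAs (CompactSpace (Quotient (wedgeSetoid fun _ : Fin m => (1 : Circle))))

instance (r : ℕ) (X : Type*) [TopologicalSpace X] [CompactSpace X] :
    CompactSpace (SymmetricProduct r X) :=
  inferInstanceAs (CompactSpace (Quotient (symmetricProductSetoid r X)))

/-! ### Finite families of points of the circle, up to the base point -/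

/-- Two finite families of points of the circle are equivalent if every continuous function that
vanishes at `1` has the same sum over both of them. -/
def SameSums {α β : Type*} [Fintype α] [Fintype β] (z : α → Circle) (z' : β → Circle) : Prop :=
  ∀ φ : C(Circle, ℝ), φ 1 = 0 → ∑ a, φ (z a) = ∑ b, φ (z' b)

/-- The multiset of the entries of a family that differ from `1`. -/
def nontrivialEntries {α : Type*} [Fintype α] (z : α → Circle) : Multiset Circle :=
  open Classical in ((Finset.univ : Finset α).val.map z).filter (· ≠ 1)

open Classical in
lemma count_nontrivialEntries {α : Type*} [Fintype α] (z : α → Circle) {p : Circle} (hp : p ≠ 1) :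
    (nontrivialEntries z).count p = (Finset.univ.filter fun a => z a = p).card := by
  rw [nontrivialEntries, Multiset.count_filter_of_pos (p := (· ≠ 1)) hp, Multiset.count_map]
  simp only [Finset.card, Finset.filter_val, eq_comm]

/-- A function that separates `p` from a finite set. -/
lemma exists_separating (p : Circle) (F : Finset Circle) (hp : p ∉ F) :
    ∃ φ : C(Circle, ℝ), φ p ≠ 0 ∧ ∀ q ∈ F, φ q = 0 := by
  refine ⟨⟨fun x => ∏ q ∈ F, dist x q, by fun_prop⟩, ?_, fun q hq => ?_⟩
  · exact Finset.prod_ne_zero_iff.2 fun q hq => dist_ne_zero.2 fun h => hp (h ▸ hq)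
  · exact Finset.prod_eq_zero hq (dist_self q)

open Classical in
lemma sum_eq_card_mul {α : Type*} [Fintype α] (z : α → Circle) (p : Circle) (φ : Circle → ℝ)
    (h : ∀ a, z a ≠ p → φ (z a) = 0) :
    ∑ a, φ (z a) = (Finset.univ.filter fun a => z a = p).card * φ p := by
  rw [← nsmul_eq_mul, ← Finset.sum_const, Finset.sum_filter]
  refine Finset.sum_congr rfl fun a _ => ?_
  split_ifs with ha
  · rw [ha]
  · exact h a ha

/-- A test function that vanishes at `1` and at all entries except `p` reads off the multiplicity of
`p`. The point `1` itself is invisible to test functions. -/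
lemma SameSums.nontrivialEntries_eq {α β : Type*} [Fintype α] [Fintype β] {z : α → Circle}
    {z' : β → Circle} (h : SameSums z z') : nontrivialEntries z = nontrivialEntries z' := by
  classical
  ext p
  by_cases hp : p = 1
  · subst hp
    rw [Multiset.count_eq_zero.2, Multiset.count_eq_zero.2] <;> simp [nontrivialEntries]
  · rw [count_nontrivialEntries z hp, count_nontrivialEntries z' hp]
    obtain ⟨φ, hφp, hφ⟩ := exists_separating p
      ((insert 1 (Finset.univ.image z ∪ Finset.univ.image z')).erase p) (by simp)
    have hs := h φ (hφ 1 (by simp [Ne.symm hp]))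
    rw [sum_eq_card_mul z p φ fun a ha => hφ _ (by simp [ha]),
      sum_eq_card_mul z' p φ fun a ha => hφ _ (by simp [ha])] at hs
    exact_mod_cast mul_right_cancel₀ hφp hs

lemma prod_nontrivialEntries {α : Type*} [Fintype α] (z : α → Circle) :
    (nontrivialEntries z).prod = ∏ a, z a := by
  classical
  rw [nontrivialEntries, Finset.prod]
  conv_rhs => rw [← Multiset.filter_add_not (· ≠ (1 : Circle)) (Multiset.map z _)]
  rw [Multiset.prod_add, left_eq_mul]
  refine Multiset.prod_eq_one fun x hx => ?_
  simpa using (Multiset.mem_filter.1 hx).2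

lemma SameSums.prod_eq {α β : Type*} [Fintype α] [Fintype β] {z : α → Circle} {z' : β → Circle}
    (h : SameSums z z') : ∏ a, z a = ∏ b, z' b := by
  rw [← prod_nontrivialEntries, ← prod_nontrivialEntries, h.nontrivialEntries_eq]

open Classical in
lemma card_filter_eq_countP {α : Type*} [Fintype α] (z : α → Circle) (P : Circle → Prop)
    (hP : ¬ P 1) :
    (Finset.univ.filter fun a => P (z a)).card = (nontrivialEntries z).countP P := by
  rw [nontrivialEntries, Multiset.countP_filter, Multiset.countP_map]
  simp only [Finset.card, Finset.filter_val]
  congr 1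
  exact Multiset.filter_congr fun c _ => ⟨fun hc => ⟨hc, fun h1 => hP (h1 ▸ hc)⟩, And.left⟩

open Classical in
lemma SameSums.card_filter_eq {α β : Type*} [Fintype α] [Fintype β] {z : α → Circle}
    {z' : β → Circle} (h : SameSums z z') (P : Circle → Prop) (hP : ¬ P 1) :
    (Finset.univ.filter fun a => P (z a)).card = (Finset.univ.filter fun b => P (z' b)).card := by
  rw [card_filter_eq_countP _ P hP, card_filter_eq_countP _ P hP, h.nontrivialEntries_eq]

/-! ### The symmetric product as a space of families of points of the circle -/

/-- The continuous functions on the circle that vanish at the base point. -/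
abbrev CircleTest : Type := {φ : C(Circle, ℝ) // φ 1 = 0}

/-- The sums of the test functions over the coordinates of an unordered tuple of points of the
wedge. -/
def testSums {m r : ℕ} (y : SymmetricProduct r (WedgeOfCircles m)) (i : Fin m)
    (φ : CircleTest) : ℝ :=
  Quotient.lift (s := symmetricProductSetoid r (WedgeOfCircles m))
    (fun w => ∑ j, φ.1 (wedgeCoord i (w j))) (by
      rintro w _ ⟨σ, rfl⟩
      exact (Equiv.sum_comp σ fun j => φ.1 (wedgeCoord i (w j))).symm) y

lemma continuous_testSums {m r : ℕ} : Continuous (testSums (m := m) (r := r)) := by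
  refine continuous_pi fun i => continuous_pi fun φ => ?_
  refine Continuous.quotient_lift ?_ _
  exact continuous_finsetSum _ fun j _ =>
    φ.1.continuous.comp ((continuous_wedgeCoord i).comp (continuous_apply j))

/-- Equal multiplicities give bijections between the fibres of `g` and `f`, which glue to a
permutation. -/
lemma exists_perm_of_map_eq {r : ℕ} {X : Type*} {f g : Fin r → X}
    (h : (Finset.univ : Finset (Fin r)).val.map f = (Finset.univ : Finset (Fin r)).val.map g) :
    ∃ σ : Equiv.Perm (Fin r), f ∘ σ = g := by
  classical
  have hc : ∀ x, Nonempty ({a // g a = x} ≃ {a // f a = x}) := by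
    intro x
    refine Fintype.card_eq.1 ?_
    have := congrArg (Multiset.count x) h
    rw [Multiset.count_map, Multiset.count_map] at this
    rw [Fintype.card_subtype, Fintype.card_subtype]
    simp only [Finset.card, Finset.filter_val, eq_comm (b := x)]
    simpa only [eq_comm (a := x)] using this.symm
  have e : ∀ x, {a // g a = x} ≃ {a // f a = x} := fun x => (hc x).some
  refine ⟨Equiv.ofFiberEquiv e, funext fun a => ?_⟩
  exact Equiv.ofFiberEquiv_map e a

lemma multiset_eq_of_count_eq_of_ne {X : Type*} [DecidableEq X] {M N : Multiset X} (b : X)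
    (hcard : M.card = N.card) (h : ∀ x, x ≠ b → M.count x = N.count x) : M = N := by
  have hf : M.filter (· ≠ b) = N.filter (· ≠ b) := by
    ext x
    by_cases hx : x = b
    · simp [hx]
    · rw [Multiset.count_filter_of_pos (p := (· ≠ b)) hx, Multiset.count_filter_of_pos (p := (· ≠ b)) hx,
        h x hx]
  ext x
  by_cases hx : x = b
  · subst hx
    have h1 := Multiset.card_eq_countP_add_countP (· = x) M
    have h2 := Multiset.card_eq_countP_add_countP (· = x) N
    rw [Multiset.countP_eq_card_filter (fun a => ¬ a = x)] at h1 h2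
    change M.filter (fun a => ¬ a = x) = _ at hf
    rw [hf] at h1
    have h3 : ∀ K : Multiset X, K.count x = K.countP (· = x) := fun K => by
      simp only [Multiset.count, eq_comm]
    rw [h3, h3]
    change M.card = _ + (N.filter (fun a => ¬ a = x)).card at h1
    omega
  · exact h x hx

/-- Test sums determine the multiplicity of every point other than the base point; that of the base
point follows because the tuple has length `r`. -/
lemma injective_testSums {m r : ℕ} : Function.Injective (testSums (m := m) (r := r)) := by
  classical
  intro y y' h
  induction y using Quotient.inductionOn with
  | h w =>
  induction y' using Quotient.inductionOn with
  | h w' =>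
    refine Quotient.sound (exists_perm_of_map_eq ?_)
    refine multiset_eq_of_count_eq_of_ne (wedgeBase m) (by simp) fun x hx => ?_
    obtain ⟨i, z, hz, rfl⟩ := (wedge_cases x).resolve_left hx
    have hs : SameSums (fun j => wedgeCoord i (w j)) (fun j => wedgeCoord i (w' j)) :=
      fun φ hφ => congrFun (congrFun h i) ⟨φ, hφ⟩
    have := hs.card_filter_eq (· = z) (Ne.symm hz)
    simp only [Multiset.count_map, ← Finset.filter_val, Finset.card_val,
      eq_comm (a := wedgeIncl i z), eq_wedgeIncl_iff hz]
    exact this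

instance (m r : ℕ) : T2Space (SymmetricProduct r (WedgeOfCircles m)) :=
  T2Space.of_injective_continuous injective_testSums continuous_testSums

/-- A continuous injection from a compact space to a Hausdorff space. Continuity of maps into the
symmetric product can thus be checked on test sums. -/
lemma isEmbedding_testSums {m r : ℕ} : IsEmbedding (testSums (m := m) (r := r)) :=
  (continuous_testSums.isClosedEmbedding injective_testSums).isEmbedding

open Classical in
-- The nontrivial points are put injectively into the `r` places and the other places receive the
-- base point, which contributes nothing to the sums.
lemma exists_testSums_eq {m r : ℕ} {α : Type*} [Fintype α] (t : Fin m → α → Circle)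
    (ht : (Finset.univ.filter fun p : Fin m × α => t p.1 p.2 ≠ 1).card ≤ r) :
    ∃ y : SymmetricProduct r (WedgeOfCircles m),
      ∀ i φ, testSums y i φ = ∑ a, φ.1 (t i a) := by
  set S := Finset.univ.filter fun p : Fin m × α => t p.1 p.2 ≠ 1 with hS
  obtain ⟨e⟩ := Function.Embedding.nonempty_of_card_le (α := S) (β := Fin r) (by simpa using ht)
  set w : Fin r → WedgeOfCircles m :=
    Function.extend e (fun p => wedgeIncl p.1.1 (t p.1.1 p.1.2)) fun _ => wedgeBase m with hw
  refine ⟨Quotient.mk _ w, fun i φ => ?_⟩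
  have h0 : testSums (Quotient.mk _ w) i φ = ∑ j, φ.1 (wedgeCoord i (w j)) := rfl
  rw [h0]
  have h1 : ∑ j, φ.1 (wedgeCoord i (w j)) = ∑ p : S, φ.1 (wedgeCoord i (w (e p))) := by
    rw [← Finset.sum_map Finset.univ e fun j => φ.1 (wedgeCoord i (w j))]
    refine (Finset.sum_subset (Finset.subset_univ _) fun j _ hj => ?_).symm
    have : w j = wedgeBase m := Function.extend_apply' _ _ _ fun ⟨p, hp⟩ => hj (by simp [← hp])
    rw [this, wedgeCoord_base, φ.2]
  have h2 : ∀ p : S, φ.1 (wedgeCoord i (w (e p))) =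
      if p.1.1 = i then φ.1 (t p.1.1 p.1.2) else 0 := by
    intro p
    rw [hw, e.injective.extend_apply, wedgeCoord_incl]
    split_ifs
    · rfl
    · exact φ.2
  rw [h1, Finset.sum_congr rfl fun p _ => h2 p,
    Finset.sum_coe_sort S fun p => if p.1 = i then φ.1 (t p.1 p.2) else 0,
    Finset.sum_subset (Finset.subset_univ S), Fintype.sum_prod_type]
  · simp [Finset.sum_ite_irrel]
  · intro p _ hp
    have : t p.1 p.2 = 1 := by simpa [hS] using hp
    simp [this, φ.2]

end

noncomputable section

/-! ### The parametrization of the circle by the unit interval -/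

/-- The parametrization `t ↦ exp (2 π i t)` of the circle. -/
def circleParam (t : ℝ) : Circle := Circle.exp (2 * Real.pi * t)

/-- The parameter in `[0, 1)` of a point of the circle. -/
def circleFract (z : Circle) : ℝ := Int.fract (Complex.arg z / (2 * Real.pi))

lemma continuous_circleParam : Continuous circleParam := by
  unfold circleParam
  fun_prop

lemma circleParam_zero : circleParam 0 = 1 := by simp [circleParam]

lemma circleParam_one : circleParam 1 = 1 := by simp [circleParam]

lemma circleParam_add (s t : ℝ) : circleParam (s + t) = circleParam s * circleParam t := by
  simp [circleParam, mul_add]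

lemma circleParam_sum {α : Type*} (s : Finset α) (x : α → ℝ) :
    circleParam (∑ a ∈ s, x a) = ∏ a ∈ s, circleParam (x a) := by
  classical
  induction s using Finset.induction_on with
  | empty => simp [circleParam_zero]
  | insert a s ha ih => rw [Finset.sum_insert ha, Finset.prod_insert ha, circleParam_add, ih]

lemma circleParam_natCast (n : ℕ) : circleParam n = 1 := by
  have := circleParam_sum (Finset.range n) fun _ => 1
  simpa [circleParam_one] using this

lemma circleParam_intCast (n : ℤ) : circleParam n = 1 := Circle.exp_two_pi_mul_int n

lemma circleParam_fract (t : ℝ) : circleParam (Int.fract t) = circleParam t := by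
  conv_rhs => rw [← Int.floor_add_fract t, circleParam_add, circleParam_intCast, one_mul]

lemma circleParam_circleFract (z : Circle) : circleParam (circleFract z) = z := by
  rw [circleFract, circleParam_fract, circleParam, mul_div_cancel₀ _ (by positivity),
    Circle.exp_arg]

lemma circleFract_mem (z : Circle) : circleFract z ∈ Ico (0 : ℝ) 1 :=
  ⟨Int.fract_nonneg _, Int.fract_lt_one _⟩

lemma circleFract_one : circleFract 1 = 0 := by simp [circleFract]

lemma circleFract_circleParam {t : ℝ} (ht : t ∈ Ico (0 : ℝ) 1) :
    circleFract (circleParam t) = t := by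
  have h := circleParam_circleFract (circleParam t)
  have hm := circleFract_mem (circleParam t)
  have hp := Real.pi_pos
  generalize circleFract (circleParam t) = s at h hm
  obtain ⟨n, hn⟩ := Circle.exp_eq_exp.1 h
  have hn' : s = t + n := by
    have : 2 * Real.pi * s = 2 * Real.pi * (t + n) := by rw [hn]; ring
    exact mul_left_cancel₀ (by positivity) this
  have h1 : (n : ℝ) < 1 := by linarith [hm.2, ht.1]
  have h2 : (-1 : ℝ) < n := by linarith [hm.1, ht.2]
  have h1' : n < 1 := by exact_mod_cast h1
  have h2' : -1 < n := by exact_mod_cast h2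
  have : n = 0 := by omega
  simp [hn', this]

/-- The condition `t < 1` is there because the parameter `1` represents the base point, whose
`circleFract` is `0`. -/
lemma lt_circleFract_circleParam_iff {a t : ℝ} (ha : 0 ≤ a) (ht : t ∈ Icc (0 : ℝ) 1) :
    a < circleFract (circleParam t) ↔ a < t ∧ t < 1 := by
  rcases ht.2.lt_or_eq with h | rfl
  · rw [circleFract_circleParam ⟨ht.1, h⟩]
    simp [h]
  · rw [circleParam_one, circleFract_one]
    simpa using ha

/-! ### Filling up a decreasing sequence from the left -/

/-- The projection of the real line onto the unit interval. -/
def clampUnit (s : ℝ) : ℝ := max 0 (min 1 s)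

lemma continuous_clampUnit : Continuous clampUnit := by
  unfold clampUnit
  fun_prop

lemma clampUnit_mem (s : ℝ) : clampUnit s ∈ Icc (0 : ℝ) 1 := by simp [clampUnit]

lemma clampUnit_mono : Monotone clampUnit := fun _ _ h => by
  unfold clampUnit
  gcongr

lemma clampUnit_of_nonpos {s : ℝ} (h : s ≤ 0) : clampUnit s = 0 :=
  max_eq_left ((min_le_right _ _).trans h)

lemma clampUnit_of_one_le {s : ℝ} (h : 1 ≤ s) : clampUnit s = 1 := by simp [clampUnit, h]

lemma clampUnit_of_mem {s : ℝ} (h : s ∈ Icc (0 : ℝ) 1) : clampUnit s = s := by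
  simp [clampUnit, h.1, h.2]

/-- The linear homotopy from a sequence `x` to the sequence with the same sum `s` that has the form
`(1, …, 1, s - k, 0, …, 0)`. -/
def fill {r : ℕ} (u : ℝ) (x : Fin r → ℝ) (j : Fin r) : ℝ :=
  (1 - u) * x j + u * clampUnit (∑ l, x l - j)

lemma continuous_fill {r : ℕ} (j : Fin r) :
    Continuous fun p : ℝ × (Fin r → ℝ) => fill p.1 p.2 j := by
  unfold fill
  have : Continuous fun p : ℝ × (Fin r → ℝ) => clampUnit (∑ l, p.2 l - j) :=
    continuous_clampUnit.comp (by fun_prop)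
  fun_prop

lemma fill_zero {r : ℕ} (x : Fin r → ℝ) : fill 0 x = x := by
  funext j
  simp [fill]

lemma fill_mem {r : ℕ} {u : ℝ} (hu : u ∈ Icc (0 : ℝ) 1) {x : Fin r → ℝ} {j : Fin r}
    (hx : x j ∈ Icc (0 : ℝ) 1) : fill u x j ∈ Icc (0 : ℝ) 1 :=
  convex_Icc 0 1 hx (clampUnit_mem _) (by linarith [hu.2]) hu.1 (by ring)

lemma fill_antitone {r : ℕ} {u : ℝ} (hu : u ∈ Icc (0 : ℝ) 1) {x : Fin r → ℝ}
    (hx : Antitone x) : Antitone (fill u x) := by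
  intro j k h
  have h1 : clampUnit (∑ l, x l - k) ≤ clampUnit (∑ l, x l - j) :=
    clampUnit_mono (sub_le_sub_left (by exact_mod_cast h) _)
  have h2 := hx h
  have h3 : 0 ≤ 1 - u := by linarith [hu.2]
  have h4 := hu.1
  unfold fill
  gcongr

lemma sum_le_of_eq_zero {r : ℕ} {x : Fin r → ℝ} (h01 : ∀ j, x j ∈ Icc (0 : ℝ) 1)
    (hx : Antitone x) {j : Fin r} (hj : x j = 0) : ∑ l, x l ≤ j := by
  have h : ∀ l, x l ≤ if l < j then 1 else 0 := by
    intro l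
    split_ifs with hl
    · exact (h01 l).2
    · exact (hx (not_lt.1 hl)).trans hj.le
  refine (Finset.sum_le_sum fun l _ => h l).trans ?_
  rw [Finset.sum_boole, show Finset.univ.filter (· < j) = Finset.Iio j by ext; simp, Fin.card_Iio]

/-- If `x j = 0`, only the `j` earlier entries contribute, so the sum is at most `j` and the target
entry is clamped to `0`. -/
lemma fill_eq_zero {r : ℕ} (u : ℝ) {x : Fin r → ℝ} (h01 : ∀ j, x j ∈ Icc (0 : ℝ) 1)
    (hx : Antitone x) {j : Fin r} (hj : x j = 0) : fill u x j = 0 := by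
  rw [fill, hj, clampUnit_of_nonpos (by linarith [sum_le_of_eq_zero h01 hx hj])]
  simp

/-- The sequences on the natural numbers that decrease from at most `1` to `0` within `r`
steps. -/
structure IsFillable (r : ℕ) (x : ℕ → ℝ) : Prop where
  antitone : Antitone x
  le_one : ∀ j, x j ≤ 1
  eq_zero : ∀ j, r ≤ j → x j = 0

lemma IsFillable.nonneg {r : ℕ} {x : ℕ → ℝ} (hx : IsFillable r x) (j : ℕ) : 0 ≤ x j := by
  rw [← hx.eq_zero (max r j) (le_max_left _ _)]
  exact hx.antitone (le_max_right _ _)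

lemma IsFillable.sum_le {r : ℕ} {x : ℕ → ℝ} (hx : IsFillable r x) :
    ∑ l ∈ Finset.range r, x l ≤ r := by
  refine (Finset.sum_le_sum fun l _ => hx.le_one l).trans ?_
  simp

/-- Indexing by all of `ℕ` lets leading entries be dropped without changing `r`. -/
lemma IsFillable.shift {r : ℕ} {x : ℕ → ℝ} (hx : IsFillable r x) (b : ℕ) :
    IsFillable r fun j => x (j + b) where
  antitone _ _ h := hx.antitone (by omega)
  le_one j := hx.le_one _
  eq_zero j h := hx.eq_zero _ (by omega)

/-- The sum of a function over the points `fill u x` of the circle. -/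
def fillSum (r : ℕ) (u : ℝ) (φ : Circle → ℝ) (x : ℕ → ℝ) : ℝ :=
  ∑ j ∈ Finset.range r,
    φ (circleParam ((1 - u) * x j + u * clampUnit (∑ l ∈ Finset.range r, x l - j)))

/-- Dropping a leading `1` does not change the points of `fill u x` other than `1`. -/
lemma fillSum_shift_one {r : ℕ} {u : ℝ} {φ : Circle → ℝ} (hφ : φ 1 = 0) {x : ℕ → ℝ}
    (hx : IsFillable r x) (h0 : x 0 = 1) : fillSum r u φ (fun j => x (j + 1)) = fillSum r u φ x := by
  have hsum : ∑ l ∈ Finset.range r, x (l + 1) = ∑ l ∈ Finset.range r, x l - 1 := by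
    have := Finset.sum_range_succ' x r
    rw [Finset.sum_range_succ, hx.eq_zero r le_rfl, h0] at this
    linarith
  have hs1 : 1 ≤ ∑ l ∈ Finset.range r, x l := by
    have : 0 ≤ ∑ l ∈ Finset.range r, x (l + 1) := Finset.sum_nonneg fun l _ => hx.nonneg _
    linarith
  unfold fillSum
  rw [hsum]
  set s := ∑ l ∈ Finset.range r, x l with hs
  -- The sum over `r + 1` indices is split at both ends. Index `r` contributes parameter `0` since
  -- the sum is at most `r`, index `0` contributes parameter `1`, and `φ` vanishes at both of these
  -- points.
  have key := Finset.sum_range_succ'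
    (fun j : ℕ => φ (circleParam ((1 - u) * x j + u * clampUnit (s - j)))) r
  rw [Finset.sum_range_succ, hx.eq_zero r le_rfl,
    clampUnit_of_nonpos (s := s - r) (by linarith [hx.sum_le]), h0,
    clampUnit_of_one_le (s := s - (0 : ℕ)) (by simpa using hs1)] at key
  simp only [mul_zero, add_zero, mul_one, sub_add_cancel, circleParam_zero, circleParam_one, hφ]
    at key
  rw [key]
  refine Finset.sum_congr rfl fun j _ => ?_
  push_cast
  rw [sub_sub, add_comm (1 : ℝ) j]

lemma fillSum_shift {r : ℕ} {u : ℝ} {φ : Circle → ℝ} (hφ : φ 1 = 0) {x : ℕ → ℝ}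
    (hx : IsFillable r x) {b : ℕ} (hb : ∀ j < b, x j = 1) :
    fillSum r u φ (fun j => x (j + b)) = fillSum r u φ x := by
  induction b with
  | zero => rfl
  | succ b ih =>
    rw [← ih fun j hj => hb j (by omega),
      ← fillSum_shift_one hφ (hx.shift b) (by simpa using hb b (by omega))]
    simp only [add_right_comm _ 1 b, add_assoc]

open Classical in
-- A finite initial segment of `ℕ` is determined by its size.
lemma iff_lt_card_of_antitone {r : ℕ} {p : ℕ → Prop} (hp : ∀ j k, j ≤ k → p k → p j)
    (hr : ∀ j, p j → j < r) (j : ℕ) : p j ↔ j < ((Finset.range r).filter p).card := by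
  constructor
  · intro h
    have : Finset.range (j + 1) ⊆ (Finset.range r).filter p := fun k hk => by
      have hk' := hp k j (by simpa [Nat.lt_succ_iff] using hk) h
      simpa using ⟨hr k hk', hk'⟩
    simpa using Finset.card_le_card this
  · intro h
    by_contra hj
    have : (Finset.range r).filter p ⊆ Finset.range j := fun k hk => by
      simp only [Finset.mem_filter, Finset.mem_range] at hk ⊢
      by_contra hkj
      exact hj (hp j k (by omega) hk.2)
    have := Finset.card_le_card this
    rw [Finset.card_range] at this
    omega

open Classical in
/-- The number of leading entries `1` of a sequence. -/
def leadingOnes (r : ℕ) (x : ℕ → ℝ) : ℕ := ((Finset.range r).filter fun j => 1 ≤ x j).card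

lemma IsFillable.one_le_iff {r : ℕ} {x : ℕ → ℝ} (hx : IsFillable r x) (j : ℕ) :
    1 ≤ x j ↔ j < leadingOnes r x := by
  refine iff_lt_card_of_antitone (p := fun j => 1 ≤ x j) (fun j k h hk => hk.trans (hx.antitone h))
    (fun j hj => ?_) j
  by_contra h
  rw [hx.eq_zero j (not_lt.1 h)] at hj
  linarith

open Classical in
/-- The entries after the leading `1`s are determined by the counts of the entries in the open
intervals `(a, 1)`. -/
lemma IsFillable.lt_shift_iff {r : ℕ} {x : ℕ → ℝ} (hx : IsFillable r x) {a : ℝ} (ha : 0 ≤ a)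
    (j : ℕ) : a < x (j + leadingOnes r x) ↔
      j < ((Finset.range r).filter fun l => a < x l ∧ x l < 1).card := by
  have hr : ∀ l, a < x l → l < r := by
    intro l hl
    by_contra h
    rw [hx.eq_zero l (not_lt.1 h)] at hl
    linarith
  have h1 := iff_lt_card_of_antitone (p := fun l => a < x l)
    (fun j k h hk => hk.trans_le (hx.antitone h)) hr
  set c := ((Finset.range r).filter fun l => a < x l).card
  -- By monotonicity, the entries in `(a, 1)` occupy the interval of indices between the leading
  -- `1`s and the entries that are at most `a`.
  have h2 : ((Finset.range r).filter fun l => a < x l ∧ x l < 1) =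
      Finset.Ico (leadingOnes r x) c := by
    ext l
    have h3 : x l < 1 ↔ leadingOnes r x ≤ l := by rw [← not_le, hx.one_le_iff, not_lt]
    rw [Finset.mem_filter, Finset.mem_range, Finset.mem_Ico, h1, h3]
    refine ⟨fun h => ⟨h.2.2, h.2.1⟩, fun h => ⟨hr l ((h1 l).2 h.2), h.2, h.1⟩⟩
  rw [h1, h2, Nat.card_Ico]
  omega

/-- Once their leading `1`s are dropped, the two sequences coincide: both are decreasing, and their
counts in each `(a, 1)` can be read on the circle through `circleFract`. -/
lemma IsFillable.fillSum_eq {r : ℕ} {x x' : ℕ → ℝ} (hx : IsFillable r x) (hx' : IsFillable r x')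
    (h : SameSums (fun j : Fin r => circleParam (x j)) fun j : Fin r => circleParam (x' j))
    (u : ℝ) {φ : Circle → ℝ} (hφ : φ 1 = 0) : fillSum r u φ x = fillSum r u φ x' := by
  classical
  have hcard : ∀ {y : ℕ → ℝ}, IsFillable r y → ∀ {a : ℝ}, 0 ≤ a →
      ((Finset.range r).filter fun l => a < y l ∧ y l < 1).card =
      (Finset.univ.filter fun j : Fin r => a < circleFract (circleParam (y j))).card := by
    intro y hy a ha
    simp only [lt_circleFract_circleParam_iff ha ⟨hy.nonneg _, hy.le_one _⟩]
    rw [Finset.card_filter, Finset.card_filter,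
      Fin.sum_univ_eq_sum_range (fun l => if a < y l ∧ y l < 1 then 1 else 0)]
  have heq : (fun j => x (j + leadingOnes r x)) = fun j => x' (j + leadingOnes r x') := by
    have key : ∀ a, 0 ≤ a → ∀ j,
        (a < x (j + leadingOnes r x) ↔ a < x' (j + leadingOnes r x')) := by
      intro a ha j
      rw [hx.lt_shift_iff ha, hx'.lt_shift_iff ha, hcard hx ha, hcard hx' ha,
        h.card_filter_eq (fun z => a < circleFract z) (by simpa [circleFract_one] using ha)]
    funext j
    -- If two entries differed, the smaller one would serve as a contradictory threshold `a`.
    refine le_antisymm (not_lt.1 fun hlt => ?_) (not_lt.1 fun hlt => ?_)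
    · exact lt_irrefl _ ((key _ (hx'.nonneg _) j).1 hlt)
    · exact lt_irrefl _ ((key _ (hx.nonneg _) j).2 hlt)
  rw [← fillSum_shift hφ hx fun j hj => le_antisymm (hx.le_one j) ((hx.one_le_iff j).2 hj),
    ← fillSum_shift hφ hx' fun j hj => le_antisymm (hx'.le_one j) ((hx'.one_le_iff j).2 hj), heq]

/-- The extension by zero of a finite sequence. -/
def extendZero {r : ℕ} (x : Fin r → ℝ) (j : ℕ) : ℝ := if h : j < r then x ⟨j, h⟩ else 0

@[simp] lemma extendZero_val {r : ℕ} (x : Fin r → ℝ) (j : Fin r) : extendZero x j = x j := by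
  simp [extendZero]

lemma isFillable_extendZero {r : ℕ} {x : Fin r → ℝ} (h01 : ∀ j, x j ∈ Icc (0 : ℝ) 1)
    (hx : Antitone x) : IsFillable r (extendZero x) where
  antitone j k h := by
    unfold extendZero
    split_ifs with hk hj hj
    · exact hx h
    · omega
    · exact (h01 _).1
    · exact le_rfl
  le_one j := by
    unfold extendZero
    split_ifs
    · exact (h01 _).2
    · exact zero_le_one
  eq_zero j h := dif_neg (not_lt.2 h)

lemma sum_fill_eq_fillSum {r : ℕ} (u : ℝ) (φ : Circle → ℝ) (x : Fin r → ℝ) :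
    ∑ j, φ (circleParam (fill u x j)) = fillSum r u φ (extendZero x) := by
  unfold fillSum
  rw [← Fin.sum_univ_eq_sum_range (extendZero x), ← Fin.sum_univ_eq_sum_range
    (fun j => φ (circleParam ((1 - u) * extendZero x j +
      u * clampUnit (∑ l : Fin r, extendZero x l - j))))]
  simp [fill]

/-- The homotopy `fill` only depends on the points of the circle other than `1` that a sequence
represents. -/
lemma sameSums_fill {r : ℕ} {x x' : Fin r → ℝ} (h01 : ∀ j, x j ∈ Icc (0 : ℝ) 1) (hx : Antitone x)
    (h01' : ∀ j, x' j ∈ Icc (0 : ℝ) 1) (hx' : Antitone x')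
    (h : SameSums (fun j => circleParam (x j)) fun j => circleParam (x' j)) (u : ℝ) :
    SameSums (fun j => circleParam (fill u x j)) fun j => circleParam (fill u x' j) := by
  intro φ hφ
  rw [sum_fill_eq_fillSum u φ x, sum_fill_eq_fillSum u φ x']
  exact (isFillable_extendZero h01 hx).fillSum_eq (isFillable_extendZero h01' hx')
    (by simpa using h) u hφ

/-- At the end of the homotopy, at most one point other than `1` is left. -/
lemma sameSums_fill_one {r : ℕ} {x : Fin r → ℝ} (h01 : ∀ j, x j ∈ Icc (0 : ℝ) 1) :
    SameSums (fun j => circleParam (fill 1 x j)) fun _ : Unit => ∏ j, circleParam (x j) := by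
  intro φ hφ
  rw [← circleParam_sum]
  set s := ∑ j, x j with hs
  have hs0 : 0 ≤ s := Finset.sum_nonneg fun j _ => (h01 j).1
  have hsr : s ≤ r := (Finset.sum_le_sum fun j _ => (h01 j).2).trans (by simp)
  have hfill : ∀ j, fill 1 x j = clampUnit (s - j) := fun j => by simp [fill, ← hs]
  have hfloor := Nat.floor_le hs0
  have hfloor' := Nat.lt_floor_add_one s
  set n := ⌊s⌋₊
  have hother : ∀ j : Fin r, (j : ℕ) ≠ n → φ (circleParam (fill 1 x j)) = 0 := by
    intro j hj
    rw [hfill]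
    rcases Nat.lt_or_gt_of_ne hj with h | h
    · have : ((j : ℕ) : ℝ) + 1 ≤ n := by exact_mod_cast h
      rw [clampUnit_of_one_le (by linarith), circleParam_one, hφ]
    · have : (n : ℝ) + 1 ≤ ((j : ℕ) : ℝ) := by exact_mod_cast h
      rw [clampUnit_of_nonpos (by linarith), circleParam_zero, hφ]
  rw [Fintype.sum_unique (ι := Unit)]
  by_cases hn : n < r
  · rw [Finset.sum_eq_single (⟨n, hn⟩ : Fin r) (fun j _ hj => hother j fun h => hj (Fin.ext h))
      (by simp), hfill, clampUnit_of_mem ⟨by simpa using hfloor, by simp; linarith⟩]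
    congr 1
    conv_rhs => rw [← sub_add_cancel s n, circleParam_add, circleParam_natCast, mul_one]
  -- Here the sum is exactly `r`: every entry is filled up to `1`, and the product is `1` as well.
  · have hrn : (r : ℝ) ≤ n := by exact_mod_cast not_lt.1 hn
    rw [Finset.sum_eq_zero fun j _ => hother j fun h => hn (h ▸ j.2),
      show s = r by linarith, circleParam_natCast, hφ]

end

noncomputable section

/-! ### Sorted parameters for the points of the symmetric product -/

open Classical in
/-- The families of `m` decreasing sequences of length `r` in `[0, 1]` with at most `r` nonzero
entries altogether. -/
def sortedParams (m r : ℕ) : Set (Fin m → Fin r → ℝ) :=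
  {t | (∀ i j, t i j ∈ Icc (0 : ℝ) 1) ∧ (∀ i, Antitone (t i)) ∧
    (Finset.univ.filter fun p : Fin m × Fin r => t p.1 p.2 ≠ 0).card ≤ r}

/-- The bound on nonzero entries is a closed condition: it is a finite union, over sets `S` of at
most `r` positions, of the condition of vanishing outside `S`. -/
lemma isCompact_sortedParams (m r : ℕ) : IsCompact (sortedParams m r) := by
  classical
  have hcube : IsCompact
      {t : Fin m → Fin r → ℝ | ∀ i, t i ∈ {x : Fin r → ℝ | ∀ j, x j ∈ Icc (0 : ℝ) 1}} :=
    isCompact_pi_infinite fun _ => isCompact_pi_infinite fun _ => isCompact_Icc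
  have happ : ∀ (i : Fin m) (j : Fin r), Continuous fun t : Fin m → Fin r → ℝ => t i j :=
    fun i j => (continuous_apply j).comp (continuous_apply i)
  have hanti : IsClosed {t : Fin m → Fin r → ℝ | ∀ i, Antitone (t i)} := by
    have : {t : Fin m → Fin r → ℝ | ∀ i, Antitone (t i)} =
        ⋂ (i) (j) (k) (_ : j ≤ k), {t : Fin m → Fin r → ℝ | t i k ≤ t i j} := by
      ext t
      simp only [mem_ofPred_eq, mem_iInter]
      exact ⟨fun h i j k hjk => h i hjk, fun h i j k hjk => h i j k hjk⟩
    rw [this]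
    exact isClosed_iInter fun i => isClosed_iInter fun j => isClosed_iInter fun k =>
      isClosed_iInter fun _ => isClosed_le (happ i k) (happ i j)
  have hcard : IsClosed {t : Fin m → Fin r → ℝ |
      (Finset.univ.filter fun p : Fin m × Fin r => t p.1 p.2 ≠ 0).card ≤ r} := by
    have : {t : Fin m → Fin r → ℝ |
        (Finset.univ.filter fun p : Fin m × Fin r => t p.1 p.2 ≠ 0).card ≤ r} =
        ⋃ S : {S : Finset (Fin m × Fin r) // S.card ≤ r},
          ⋂ p : {p : Fin m × Fin r // p ∉ S.1}, {t | t p.1.1 p.1.2 = 0} := by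
      ext t
      simp only [mem_ofPred_eq, mem_iUnion, mem_iInter]
      refine ⟨fun h => ⟨⟨_, h⟩, fun p => by simpa using p.2⟩, fun ⟨S, hS⟩ => ?_⟩
      refine (Finset.card_le_card fun p hp => ?_).trans S.2
      by_contra hpS
      exact (Finset.mem_filter.1 hp).2 (hS ⟨p, hpS⟩)
    rw [this]
    exact isClosed_iUnion_of_finite fun S => isClosed_iInter fun p =>
      isClosed_eq (happ _ _) continuous_const
  exact hcube.inter_right (hanti.inter hcard)

instance (m r : ℕ) : CompactSpace (sortedParams m r) :=
  isCompact_iff_compactSpace.1 (isCompact_sortedParams m r)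

lemma fill_mem_sortedParams {m r : ℕ} {u : ℝ} (hu : u ∈ Icc (0 : ℝ) 1) {t : Fin m → Fin r → ℝ}
    (ht : t ∈ sortedParams m r) : (fun i => fill u (t i)) ∈ sortedParams m r := by
  refine ⟨fun i j => fill_mem hu (ht.1 i j), fun i => fill_antitone hu (ht.2.1 i),
    (Finset.card_le_card fun p hp => ?_).trans ht.2.2⟩
  rw [Finset.mem_filter] at hp ⊢
  exact ⟨hp.1, fun h => hp.2 (fill_eq_zero u (ht.1 p.1) (ht.2.1 p.1) h)⟩

lemma exists_testSums_param {m r : ℕ} (t : sortedParams m r) :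
    ∃ y : SymmetricProduct r (WedgeOfCircles m),
      ∀ i φ, testSums y i φ = ∑ j, φ.1 (circleParam (t.1 i j)) := by
  classical
  refine exists_testSums_eq (fun i j => circleParam (t.1 i j))
    ((Finset.card_le_card fun p hp => ?_).trans t.2.2.2)
  rw [Finset.mem_filter] at hp ⊢
  exact ⟨hp.1, fun h => hp.2 (by rw [h, circleParam_zero])⟩

/-- The point of the symmetric product with the given parameters. -/
def ofParams {m r : ℕ} (t : sortedParams m r) : SymmetricProduct r (WedgeOfCircles m) :=
  (exists_testSums_param t).choose

lemma testSums_ofParams {m r : ℕ} (t : sortedParams m r) (i : Fin m) (φ : CircleTest) :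
    testSums (ofParams t) i φ = ∑ j, φ.1 (circleParam (t.1 i j)) :=
  (exists_testSums_param t).choose_spec i φ

lemma continuous_ofParams {m r : ℕ} : Continuous (ofParams (m := m) (r := r)) := by
  rw [isEmbedding_testSums.continuous_iff]
  refine continuous_pi fun i => continuous_pi fun φ => ?_
  simp only [Function.comp_apply, testSums_ofParams]
  exact continuous_finsetSum _ fun j _ => φ.1.continuous.comp (continuous_circleParam.comp
    ((continuous_apply j).comp ((continuous_apply i).comp continuous_subtype_val)))

lemma exists_antitone_comp_perm {r : ℕ} (x : Fin r → ℝ) :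
    ∃ σ : Equiv.Perm (Fin r), Antitone (x ∘ σ) :=
  ⟨Tuple.sort (fun j => -x j), fun _ _ h => neg_le_neg_iff.1 (Tuple.monotone_sort (fun j => -x j) h)⟩

lemma surjective_ofParams {m r : ℕ} : Function.Surjective (ofParams (m := m) (r := r)) := by
  classical
  intro y
  induction y using Quotient.inductionOn with
  | h w =>
    choose σ hσ using fun i : Fin m =>
      exists_antitone_comp_perm fun j => circleFract (wedgeCoord i (w j))
    refine ⟨⟨fun i j => circleFract (wedgeCoord i (w (σ i j))), fun i j =>
      Ico_subset_Icc_self (circleFract_mem _), hσ, ?_⟩, injective_testSums ?_⟩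
    -- Each nonzero parameter is sent to the entry of the tuple it comes from. This is injective
    -- because a point of the wedge has at most one nontrivial coordinate.
    · refine (Finset.card_le_card_of_injOn (t := Finset.univ) (fun p => σ p.1 p.2)
        (by simp) ?_).trans (by simp)
      rintro ⟨i, j⟩ hp ⟨k, l⟩ hq h
      have hp' : wedgeCoord i (w (σ i j)) ≠ 1 := fun h1 => by
        simp [h1, circleFract_one] at hp
      have hq' : wedgeCoord k (w (σ k l)) ≠ 1 := fun h1 => by
        simp [h1, circleFract_one] at hq
      change σ i j = σ k l at h
      rw [← h] at hq'
      have hik : i = k := by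
        by_contra hne
        exact hp' (wedgeCoord_eq_one_of_ne hq' hne)
      subst hik
      rw [(σ i).injective h]
    · funext i φ
      rw [testSums_ofParams]
      simp only [circleParam_circleFract]
      exact Equiv.sum_comp (σ i) fun j => φ.1 (wedgeCoord i (w j))

/-! ### The homotopy equivalence with the skeleton of the torus -/

/-- The points of the torus with at most `r` coordinates different from `1`. -/
def torusOfSupportLe (m r : ℕ) : Set (Fin m → Circle) := {x | (torusSupport x).card ≤ r}

/-- The coordinatewise product of the points of an unordered tuple. -/
def coordProd {m r : ℕ} (y : SymmetricProduct r (WedgeOfCircles m)) (i : Fin m) : Circle :=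
  Quotient.lift (s := symmetricProductSetoid r (WedgeOfCircles m))
    (fun w => ∏ j, wedgeCoord i (w j)) (by
      rintro w _ ⟨σ, rfl⟩
      exact (Equiv.prod_comp σ fun j => wedgeCoord i (w j)).symm) y

lemma continuous_coordProd {m r : ℕ} : Continuous (coordProd (m := m) (r := r)) := by
  refine continuous_pi fun i => ?_
  refine Continuous.quotient_lift ?_ _
  exact continuous_finsetProd _ fun j _ => (continuous_wedgeCoord i).comp (continuous_apply j)

/-- The product only sees the entries other than `1`, and these are determined by the test sums. -/
lemma coordProd_eq_prod {m r : ℕ} {α : Type*} [Fintype α] {y : SymmetricProduct r (WedgeOfCircles m)}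
    {i : Fin m} {z : α → Circle} (h : ∀ φ, testSums y i φ = ∑ a, φ.1 (z a)) :
    coordProd y i = ∏ a, z a := by
  induction y using Quotient.inductionOn with
  | h w => exact SameSums.prod_eq (z := fun j => wedgeCoord i (w j)) fun φ hφ => h ⟨φ, hφ⟩

/-- A nontrivial product needs a nontrivial factor on the same circle, and there are at most `r`
nonzero parameters in all. -/
lemma coordProd_mem {m r : ℕ} (y : SymmetricProduct r (WedgeOfCircles m)) :
    coordProd y ∈ torusOfSupportLe m r := by
  classical
  obtain ⟨t, rfl⟩ := surjective_ofParams y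
  refine le_trans ?_ t.2.2.2
  refine (Finset.card_le_card fun i hi => ?_).trans (Finset.card_image_le (f := Prod.fst))
  rw [mem_torusSupport, coordProd_eq_prod (testSums_ofParams t i)] at hi
  obtain ⟨j, -, hj⟩ := Finset.exists_ne_one_of_prod_ne_one hi
  rw [Finset.mem_image]
  exact ⟨(i, j), by simpa using fun h => hj (by rw [h, circleParam_zero]), rfl⟩

lemma exists_testSums_torus {m r : ℕ} (x : torusOfSupportLe m r) :
    ∃ y : SymmetricProduct r (WedgeOfCircles m), ∀ i φ, testSums y i φ = φ.1 (x.1 i) := by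
  classical
  obtain ⟨y, hy⟩ := exists_testSums_eq (r := r) (fun (i : Fin m) (_ : Unit) => x.1 i) (by
    refine le_trans ?_ x.2
    refine Finset.card_le_card_of_injOn Prod.fst (fun p hp => ?_) fun p _ q _ h => Prod.ext h rfl
    exact Finset.mem_coe.2 (mem_torusSupport.2 (by simpa using hp)))
  exact ⟨y, fun i φ => by simpa using hy i φ⟩

/-- The unordered tuple of the coordinates of a point of the torus, each of them placed on its
circle of the wedge. -/
def ofTorus {m r : ℕ} (x : torusOfSupportLe m r) : SymmetricProduct r (WedgeOfCircles m) :=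
  (exists_testSums_torus x).choose

lemma testSums_ofTorus {m r : ℕ} (x : torusOfSupportLe m r) (i : Fin m) (φ : CircleTest) :
    testSums (ofTorus x) i φ = φ.1 (x.1 i) :=
  (exists_testSums_torus x).choose_spec i φ

lemma continuous_ofTorus {m r : ℕ} : Continuous (ofTorus (m := m) (r := r)) := by
  rw [isEmbedding_testSums.continuous_iff]
  refine continuous_pi fun i => continuous_pi fun φ => ?_
  simp only [Function.comp_apply, testSums_ofTorus]
  exact φ.1.continuous.comp ((continuous_apply i).comp continuous_subtype_val)

lemma coordProd_ofTorus {m r : ℕ} (x : torusOfSupportLe m r) : coordProd (ofTorus x) = x.1 := by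
  funext i
  rw [coordProd_eq_prod (z := fun _ : Unit => x.1 i) fun φ => by simp [testSums_ofTorus]]
  simp

/-- The map `fill` on parameters. -/
def fillParams {m r : ℕ} (u : unitInterval) (t : sortedParams m r) : sortedParams m r :=
  ⟨fun i => fill u (t.1 i), fill_mem_sortedParams u.2 t.2⟩

lemma continuous_fillParams {m r : ℕ} :
    Continuous fun p : unitInterval × sortedParams m r => fillParams p.1 p.2 := by
  refine Continuous.subtype_mk (continuous_pi fun i => continuous_pi fun j => ?_) _
  exact (continuous_fill j).comp ((continuous_subtype_val.comp continuous_fst).prodMk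
    ((continuous_apply i).comp (continuous_subtype_val.comp continuous_snd)))

/-- This makes `fillSymm` independent of the parameters chosen by `Function.surjInv`. -/
lemma ofParams_fillParams_congr {m r : ℕ} {t t' : sortedParams m r} (h : ofParams t = ofParams t')
    (u : unitInterval) : ofParams (fillParams u t) = ofParams (fillParams u t') := by
  refine injective_testSums (funext fun i => funext fun φ => ?_)
  rw [testSums_ofParams, testSums_ofParams]
  refine sameSums_fill (t.2.1 i) (t.2.2.1 i) (t'.2.1 i) (t'.2.2.1 i) (fun ψ hψ => ?_) u φ.1 φ.2
  rw [← testSums_ofParams t i ⟨ψ, hψ⟩, h, testSums_ofParams]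

/-- The deformation of the symmetric product induced by `fill`. -/
def fillSymm {m r : ℕ} (p : unitInterval × SymmetricProduct r (WedgeOfCircles m)) :
    SymmetricProduct r (WedgeOfCircles m) :=
  ofParams (fillParams p.1 (Function.surjInv surjective_ofParams p.2))

lemma fillSymm_ofParams {m r : ℕ} (u : unitInterval) (t : sortedParams m r) :
    fillSymm (u, ofParams t) = ofParams (fillParams u t) :=
  ofParams_fillParams_congr (Function.surjInv_eq surjective_ofParams _) u

/-- The chosen parameters need not depend continuously on the point. Continuity descends instead
along a surjection from a compact space to a Hausdorff space, which is a quotient map. -/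
lemma continuous_fillSymm {m r : ℕ} : Continuous (fillSymm (m := m) (r := r)) := by
  have hq : IsQuotientMap
      (Prod.map id ofParams : unitInterval × sortedParams m r → _) :=
    IsQuotientMap.of_surjective_continuous (Function.surjective_id.prodMap surjective_ofParams)
      (continuous_id.prodMap continuous_ofParams)
  rw [hq.continuous_iff]
  have : fillSymm ∘ (Prod.map id ofParams : unitInterval × sortedParams m r → _) =
      fun p => ofParams (fillParams p.1 p.2) := funext fun p => fillSymm_ofParams p.1 p.2
  rw [this]
  exact continuous_ofParams.comp continuous_fillParams

lemma fillSymm_zero {m r : ℕ} (y : SymmetricProduct r (WedgeOfCircles m)) :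
    fillSymm (0, y) = y := by
  obtain ⟨t, rfl⟩ := surjective_ofParams y
  rw [fillSymm_ofParams]
  congr 1
  refine Subtype.ext (funext fun i => ?_)
  simp [fillParams, fill_zero]

lemma fillSymm_one {m r : ℕ} (y : SymmetricProduct r (WedgeOfCircles m)) :
    fillSymm (1, y) = ofTorus ⟨coordProd y, coordProd_mem y⟩ := by
  obtain ⟨t, rfl⟩ := surjective_ofParams y
  rw [fillSymm_ofParams]
  refine injective_testSums (funext fun i => funext fun φ => ?_)
  rw [testSums_ofParams, testSums_ofTorus]
  have := sameSums_fill_one (t.2.1 i) φ.1 φ.2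
  rw [← coordProd_eq_prod (testSums_ofParams t i)] at this
  simpa [fillParams] using this

/-- The `r`-fold symmetric product of a wedge of circles is homotopy equivalent to the space of
the points of the torus with at most `r` coordinates different from `1`. -/
def symmetricProductHomotopyEquiv (m r : ℕ) :
    SymmetricProduct r (WedgeOfCircles m) ≃ₕ torusOfSupportLe m r where
  toFun := ⟨fun y => ⟨coordProd y, coordProd_mem y⟩, continuous_coordProd.subtype_mk _⟩
  invFun := ⟨ofTorus, continuous_ofTorus⟩
  left_inv := ContinuousMap.Homotopic.symm
    ⟨{ toFun := fillSymm
       continuous_toFun := continuous_fillSymm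
       map_zero_left := fillSymm_zero
       map_one_left := fillSymm_one }⟩
  right_inv := by
    have h : ∀ x : torusOfSupportLe m r,
        (⟨coordProd (ofTorus x), coordProd_mem _⟩ : torusOfSupportLe m r) = x :=
      fun x => Subtype.ext (coordProd_ofTorus x)
    convert ContinuousMap.Homotopic.refl (ContinuousMap.id (torusOfSupportLe m r)) using 1
    exact ContinuousMap.ext h

/-! ### The skeleta of the torus -/

lemma torusOfSupportLe_eq_univ {m r : ℕ} (h : m ≤ r) : torusOfSupportLe m r = univ :=
  eq_univ_of_forall fun x => (Finset.card_le_univ (torusSupport x)).trans (by simpa using h)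

lemma iUnion_coordSubtorus {m r : ℕ} (h : r ≤ m) :
    ⋃ (I : Finset (Fin m)) (_ : I.card = r), coordSubtorus I = torusOfSupportLe m r := by
  ext x
  simp only [mem_iUnion, exists_prop]
  constructor
  · rintro ⟨I, rfl, hx⟩
    refine Finset.card_le_card fun i hi => ?_
    by_contra hiI
    exact mem_torusSupport.1 hi (hx i hiI)
  · intro hx
    -- A support with fewer than `r` elements can be enlarged to exactly `r` because `r ≤ m`.
    obtain ⟨I, hsub, hI⟩ := Finset.exists_superset_card_eq hx (by simpa using h)
    refine ⟨I, hI, fun i hi => ?_⟩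
    by_contra hne
    exact hi (hsub (mem_torusSupport.2 hne))

/-- The skeleton is the union of the open cells of dimension less than `r + 1`, and the open cell
containing `x` is the one indexed by the support of `x`. -/
lemma skeleton_torus (m r : ℕ) :
    (CWComplex.skeleton (univ : Set (Fin m → Circle)) r : Set (Fin m → Circle)) =
      torusOfSupportLe m r := by
  rw [← CWComplex.iUnion_openCell_eq_skeleton]
  ext x
  simp only [mem_iUnion, exists_prop]
  have hcell : ∀ (n : ℕ) (I : {I : Finset (Fin m) // I.card = n}),
      RelCWComplex.openCell (C := (univ : Set (Fin m → Circle))) n I = torusOpenCell I.1 :=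
    fun n I => image_ball_torusCell I.1 I.2
  constructor
  · rintro ⟨n, hn, ⟨I, hI⟩, hx⟩
    have hx' : x ∈ torusOpenCell I := by
      rw [← hcell n ⟨I, hI⟩]
      exact hx
    have hIx : torusSupport x = I := Finset.ext fun i => mem_torusSupport.trans (hx' i)
    change (torusSupport x).card ≤ r
    rw [hIx, hI]
    exact Nat.lt_succ_iff.1 (by exact_mod_cast hn)
  · intro hx
    refine ⟨(torusSupport x).card, ?_, ⟨torusSupport x, rfl⟩, ?_⟩
    · exact_mod_cast Nat.lt_succ_iff.2 hx
    · exact (hcell _ _).symm ▸ mem_torusOpenCell_support x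

lemma injective_coordSubtorus {m : ℕ} :
    Function.Injective (coordSubtorus : Finset (Fin m) → Set (Fin m → Circle)) := by
  classical
  have h : ∀ {I J : Finset (Fin m)}, coordSubtorus I ⊆ coordSubtorus J → I ⊆ J := by
    intro I J h i hi
    by_contra hiJ
    -- The value `circleCell 0` is `-1`; any point other than `1` would do.
    have hmem : (Function.update 1 i (circleCell 0) : Fin m → Circle) ∈ coordSubtorus I := by
      intro k hk
      rw [Function.update_of_ne (fun h : k = i => hk (by rwa [h]))]
      rfl
    have := h hmem i hiJ
    rw [Function.update_self] at this
    exact circleCell_ne_one (by norm_num) (by norm_num) this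
  exact fun I J hIJ => (h hIJ.subset).antisymm (h hIJ.superset)

lemma ncard_coordSubtorus (m r : ℕ) :
    {T : Set (Fin m → Circle) |
      ∃ I : Finset (Fin m), I.card = r ∧ T = coordSubtorus I}.ncard = m.choose r := by
  have : {T : Set (Fin m → Circle) | ∃ I : Finset (Fin m), I.card = r ∧ T = coordSubtorus I} =
      coordSubtorus '' (Finset.powersetCard r (Finset.univ : Finset (Fin m)) : Set _) := by
    ext T
    simp [eq_comm]
  rw [this, ncard_image_of_injective _ injective_coordSubtorus, ncard_coe_finset,
    Finset.card_powersetCard, Finset.card_univ, Fintype.card_fin]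

end

theorem lemma5p1 (m r : ℕ) :
    (m ≤ r →
      Nonempty (SymmetricProduct r (WedgeOfCircles m) ≃ₕ (Fin m → Circle))) ∧
    (r < m →
      Nonempty (SymmetricProduct r (WedgeOfCircles m) ≃ₕ
        (⋃ (I : Finset (Fin m)) (_ : I.card = r), coordSubtorus I : Set (Fin m → Circle))) ∧
      {T : Set (Fin m → Circle) |
        ∃ I : Finset (Fin m), I.card = r ∧ T = coordSubtorus I}.ncard = m.choose r ∧
      (CWComplex.skeleton (univ : Set (Fin m → Circle)) r : Set (Fin m → Circle)) =
        ⋃ (I : Finset (Fin m)) (_ : I.card = r), coordSubtorus I) := by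
  refine ⟨fun h => ⟨?_⟩, fun h => ⟨⟨?_⟩, ncard_coordSubtorus m r, ?_⟩⟩
  · exact (symmetricProductHomotopyEquiv m r).trans
      ((Homeomorph.setCongr (torusOfSupportLe_eq_univ h)).trans
        (Homeomorph.Set.univ _)).toHomotopyEquiv
  · exact (symmetricProductHomotopyEquiv m r).trans
      (Homeomorph.setCongr (iUnion_coordSubtorus h.le).symm).toHomotopyEquiv
  · rw [skeleton_torus, iUnion_coordSubtorus h.le]
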